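/- Let $T$ be a straight-line tree in $\mathbb{R}^m$: a finite tree whose vertices are distinct points of $\mathbb{R}^m$ and whose edges are line segments, where a vertex lies on an edge only as an endpoint and two distinct edges meet only in common endpoints. Let $\varepsilon\ge 0$, and for $S\subseteq\mathbb{R}^m$ let $S^{\varepsilon}=\{p : \exists q\in S,\ d(p,q)\le\varepsilon\}$, where $d$ is the Euclidean distance. Let $\theta(T)\in(0,\pi]$ be the smallest angle between two distinct edges of $T$ sharing a vertex (with $\theta(T)=\pi$ if there are no two such edges). Let $C\subset\mathbb{R}^m$ be a finite set that is an $\varepsilon$-sample of $T$, i.e. $C\subseteq T^{\varepsilon}$. Let $G$ be a connected graph with vertex set $C$, let $l_{\max}(G)$ be the largest Euclidean length of an edge of $G$ ($0$ if $G$ has no edges), and let $d_G$ be the path metric of $G$, in which every edge has its Euclidean length. Let $\gamma\ge 1$ and assume that $G$ is a $\gamma$-approximation of $(T,C)$: 1. whenever $a,b\in C\cap e^{\varepsilon}$ for one edge $e$ of $T$, then $d_G(a,b)\le\gamma\, d(a,b)$; 2. for any two distinct edges $e,h$ of $T$ without a common vertex, $\min_{x\in e,\,y\in h} d(x,y) >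 l_{\max}(G)+2\varepsilon$. Let $D\subseteq C$ be $\delta$-sparse in the metric $d_G$, i.e. $d_G(p,q)\ge\delta$ for all distinct $p,q\in D$, and suppose that every vertex of $T$ lies in $D^{\varepsilon}$. Assume finally that $$\delta\ \ge\ 2\gamma\left(\varepsilon+\frac{\varepsilon}{\sin\frac{\theta(T)}{2}}+\frac{l_{\max}(G)}{\sin\left(\min\left(\theta(T),\frac{\pi}{2}\right)\right)}\right).$$ Let $\mathrm{MST}(D,d_G)$ be any minimum spanning tree of the finite metric space $(D,d_G)$, regarded as the subset of $\mathbb{R}^m$ consisting of its vertices and its straight-line edges. Then every point of $C$ lies within Euclidean distance $2\varepsilon$ of $\mathrm{MST}(D,d_G)$; that is, the directed Hausdorff distance satisfies $$\max_{p\in C}\ \min_{q\in \mathrm{MST}(D,d_G)} d(p,q)\ \le\ 2\varepsilon .$$ -/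

import Mathlib

open scoped Classical in
/-- `W` is a minimum spanning tree of the complete graph on the finite set `V` whose edges carry
the weights `w`: it is a tree on all of `V`, of smallest total weight among all such trees. -/
def IsMinSpanningTree {V : Type*} [Fintype V] (w : Sym2 V → ℝ) (W : SimpleGraph V) : Prop :=
  W.IsTree ∧ ∀ W' : SimpleGraph V, W'.IsTree →
    ∑ e ∈ W.edgeFinset, w e ≤ ∑ e ∈ W'.edgeFinset, w e

section SpatialGraphs

variable {m : ℕ} {V : Finset (EuclideanSpace ℝ (Fin m))}

/-- The subset of `ℝ^m` formed by the vertices and the straight-line edges of a graph whose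
vertices are points of `ℝ^m`. -/
def spatialRealization (G : SimpleGraph V) : Set (EuclideanSpace ℝ (Fin m)) :=
  (V : Set (EuclideanSpace ℝ (Fin m))) ∪
    {x | ∃ a b : V, G.Adj a b ∧ x ∈ segment ℝ (a : EuclideanSpace ℝ (Fin m)) b}

/-- A straight-line tree in `ℝ^m`: a tree whose vertices are points of `ℝ^m` and whose edges are
line segments, such that a vertex lies on an edge only as one of its endpoints and two distinct
edges meet only in common endpoints. -/
structure IsStraightLineTree (T : SimpleGraph V) : Prop where
  isTree : T.IsTree
  vertex_on_edge : ∀ a b c : V, T.Adj a b →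
    (c : EuclideanSpace ℝ (Fin m)) ∈ segment ℝ (a : EuclideanSpace ℝ (Fin m)) b → c = a ∨ c = b
  edge_inter_edge : ∀ a b c d : V, T.Adj a b → T.Adj c d → s(a, b) ≠ s(c, d) →
    ∀ x ∈ segment ℝ (a : EuclideanSpace ℝ (Fin m)) b,
      x ∈ segment ℝ (c : EuclideanSpace ℝ (Fin m)) d →
        ∃ v : V, (v : EuclideanSpace ℝ (Fin m)) = x ∧ (v = a ∨ v = b) ∧ (v = c ∨ v = d)

/-- The closed `ε`-offset of a subset of `ℝ^m`. -/
def offset (S : Set (EuclideanSpace ℝ (Fin m))) (ε : ℝ) : Set (EuclideanSpace ℝ (Fin m)) :=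
  {p | ∃ q ∈ S, dist p q ≤ ε}

/-- The minimal distance between two subsets of `ℝ^m`. -/
noncomputable def minDist (A B : Set (EuclideanSpace ℝ (Fin m))) : ℝ :=
  sInf (Set.image2 dist A B)

/-- The length of a longest edge (`0` if there are no edges). -/
noncomputable def maxEdgeLength (G : SimpleGraph V) : ℝ :=
  sSup {r | ∃ a b : V, G.Adj a b ∧ r = dist (a : EuclideanSpace ℝ (Fin m)) b}

/-- The smallest angle between two distinct edges with a common vertex. Angles take values in
`[0, π]`, so inserting `π` matters only if there are no two such edges; the value is then `π`. -/
noncomputable def minAngle (T : SimpleGraph V) : ℝ :=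
  sInf (insert Real.pi {r | ∃ a b c : V, T.Adj a b ∧ T.Adj a c ∧ b ≠ c ∧
    r = EuclideanGeometry.angle (b : EuclideanSpace ℝ (Fin m)) a c})

/-- The Euclidean length of a walk. -/
noncomputable def walkLength {G : SimpleGraph V} {a b : V} (p : G.Walk a b) : ℝ :=
  (p.darts.map fun d =>
    dist (d.fst : EuclideanSpace ℝ (Fin m)) (d.snd : EuclideanSpace ℝ (Fin m))).sum

/-- The path metric `d_G` of a connected graph with vertices in `ℝ^m`: the smallest Euclidean
length of a walk joining two vertices. -/
noncomputable def pathDist (G : SimpleGraph V) (a b : V) : ℝ :=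
  ⨅ p : G.Walk a b, walkLength p

theorem walkLength_reverse {G : SimpleGraph V} {a b : V} (p : G.Walk a b) :
    walkLength p.reverse = walkLength p := by
  simp only [walkLength, SimpleGraph.Walk.darts_reverse, List.map_reverse, List.sum_reverse,
    List.map_map]
  congr 1
  refine List.map_congr_left fun d _ => ?_
  simp [dist_comm]

theorem pathDist_comm (G : SimpleGraph V) (a b : V) : pathDist G a b = pathDist G b a :=
  Equiv.iInf_congr
    ⟨fun p => p.reverse, fun p => p.reverse, fun p => p.reverse_reverse,
      fun p => p.reverse_reverse⟩
    fun p => walkLength_reverse p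

/-- The path metric `d_G` restricted to a subset `D` of the vertex set, as a weight on unordered
pairs of points of `D`. -/
noncomputable def pathWeight (G : SimpleGraph V) {D : Finset (EuclideanSpace ℝ (Fin m))}
    (hD : D ⊆ V) : Sym2 D → ℝ :=
  Sym2.lift ⟨fun a b => pathDist G ⟨a, hD a.2⟩ ⟨b, hD b.2⟩, fun _ _ => pathDist_comm G _ _⟩

/-- `D ⊆ V` is `δ`-sparse in the path metric `d_G`. -/
def IsSparse (G : SimpleGraph V) {D : Finset (EuclideanSpace ℝ (Fin m))} (hD : D ⊆ V)
    (δ : ℝ) : Prop :=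
  ∀ a b : D, a ≠ b → δ ≤ pathDist G ⟨a, hD a.2⟩ ⟨b, hD b.2⟩

/-- The cloud `C` is an `ε`-sample of the graph `T`. -/
def IsSample (C : Finset (EuclideanSpace ℝ (Fin m))) (T : SimpleGraph V) (ε : ℝ) : Prop :=
  ∀ p ∈ C, p ∈ offset (spatialRealization T) ε

/-- The connected graph `G` on the cloud `C` is a `γ`-approximation of `(T, C)`, where `C` is
understood as an `ε`-sample of `T`. -/
structure IsGammaApprox {C : Finset (EuclideanSpace ℝ (Fin m))} (T : SimpleGraph V)
    (G : SimpleGraph C) (ε γ : ℝ) : Prop where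
  connected : G.Connected
  pathDist_le : ∀ u v : V, T.Adj u v → ∀ a b : C,
    (a : EuclideanSpace ℝ (Fin m)) ∈ offset (segment ℝ (u : EuclideanSpace ℝ (Fin m)) v) ε →
    (b : EuclideanSpace ℝ (Fin m)) ∈ offset (segment ℝ (u : EuclideanSpace ℝ (Fin m)) v) ε →
      pathDist G a b ≤ γ * dist (a : EuclideanSpace ℝ (Fin m)) b
  lt_minDist : ∀ u v x y : V, T.Adj u v → T.Adj x y → u ≠ x → u ≠ y → v ≠ x → v ≠ y →
    maxEdgeLength G + 2 * ε <
      minDist (segment ℝ (u : EuclideanSpace ℝ (Fin m)) v)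
        (segment ℝ (x : EuclideanSpace ℝ (Fin m)) y)

/-- The directed Hausdorff distance `max_{p ∈ C} min_{q ∈ S} d(p, q)`. -/
noncomputable def directedHausdorffDist (S : Set (EuclideanSpace ℝ (Fin m)))
    (C : Finset (EuclideanSpace ℝ (Fin m))) : ℝ :=
  ⨆ p : C, Metric.infDist (p : EuclideanSpace ℝ (Fin m)) S

end SpatialGraphs

/-!
Since `C` lies in the `ε`-offset of the tree `T`, it suffices that `T` lies in the `ε`-offset of the
minimum spanning tree `W` on `D`.

The metric input is a wedge estimate (`dist_apex_le`): points at distance at most `l` from each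
other in the offsets of two edges with a common vertex `z` lie within
`ε / sin (θ / 2) + l / sin (min θ (π / 2))` of `z`. With `l = 0` and sparsity it shows that two
offsets of edges share no point of `D` except the one near a common vertex
(`IsSparse.exists_eq_of_mem_edgeOffset_inter`). With `l` the length of a longest edge of `G` it
shows that a walk in `G` passes from one offset to another only near a common vertex.

Consequently each edge `pq` of `W` has both endpoints in the offset of a single edge of `T`
(`exists_mem_edgeOffset_of_adj`): otherwise a nearly shortest walk in `G` from `p` to `q` changes
offsets near a vertex of `T`, and the bound on `δ` makes the point `r` of `D` near that vertex closer
in `d_G` to both `p` and `q` than these are to each other, against the cycle property of minimum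
spanning trees (`IsMinSpanningTree.le_max`).

Finally, let `x` be a point of an edge `uv` of `T`. If the point of `D` near `u` projects to
the line `uv` before `x` and the one near `v` projects beyond `x`, then `x` cuts `T`, and with it `D`, into two parts. Some
edge of `W` crosses this cut. As its endpoints share an offset, that offset is the one of `uv`,
which is convex, so the edge meets the hyperplane through `x` orthogonal to `uv` within `ε` of `x`
(`exists_mem_spatialRealization_dist_le`). Otherwise one of these two points of `D` is itself within
`ε` of `x`.
-/

/-! ### Distance to the apex of a wedge -/

/-- The distance from a point at distance `r` from the apex of a ray, seen at angle `α` from the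
ray, to any point of the ray is at least `r` if `α` is obtuse and at least `r * sin α` otherwise. -/
theorem norm_mul_sin_min_angle_le {E : Type*} [NormedAddCommGroup E] [InnerProductSpace ℝ E]
    (c e : E) {t : ℝ} (ht : 0 ≤ t) :
    ‖c‖ * Real.sin (min (InnerProductGeometry.angle c e) (Real.pi / 2)) ≤ ‖c - t • e‖ := by
  have hin := InnerProductGeometry.cos_angle_mul_norm_mul_norm c e
  set α := InnerProductGeometry.angle c e with hα
  have hα0 : 0 ≤ α := InnerProductGeometry.angle_nonneg c e
  have hαπ : α ≤ Real.pi := InnerProductGeometry.angle_le_pi c e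
  have hsq : ‖c - t • e‖ ^ 2 =
      ‖c‖ ^ 2 - 2 * (t * ‖e‖) * (‖c‖ * Real.cos α) + (t * ‖e‖) ^ 2 := by
    rw [norm_sub_sq_real, inner_smul_right, norm_smul, Real.norm_of_nonneg ht, ← hin]
    ring
  apply le_of_sq_le_sq _ (norm_nonneg _)
  rw [hsq]
  rcases le_total α (Real.pi / 2) with h | h
  · rw [min_eq_left h]
    have := Real.sin_sq_add_cos_sq α
    nlinarith [sq_nonneg (‖c‖ * Real.cos α - t * ‖e‖)]
  · rw [min_eq_right h, Real.sin_pi_div_two]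
    have hcos : Real.cos α ≤ 0 := Real.cos_nonpos_of_pi_div_two_le_of_le h (by linarith)
    have h1 : 0 ≤ (t * ‖e‖) * (‖c‖ * -Real.cos α) := by
      have : 0 ≤ -Real.cos α := by linarith
      positivity
    nlinarith [sq_nonneg (t * ‖e‖)]

/-- The trigonometric core of the wedge estimate. The right side is concave in `α`, so it suffices
to compare at the ends `max 0 (θ - π / 2)` and `θ / 2` of the range of `α`. -/
theorem sin_half_mul_sin_min_le {θ α : ℝ} (hθ : 0 < θ) (hθπ : θ ≤ Real.pi) (hα0 : 0 ≤ α)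
    (hα1 : θ - Real.pi / 2 ≤ α) (hα2 : α ≤ θ / 2) :
    Real.sin (θ / 2) * Real.sin (min θ (Real.pi / 2)) ≤
      Real.sin (θ / 2) * Real.sin (θ - α) +
        Real.sin α * (Real.sin (min θ (Real.pi / 2)) - Real.sin (θ / 2)) := by
  have hπ := Real.pi_pos
  set h := Real.sin (θ / 2) with hh
  set s := Real.sin (min θ (Real.pi / 2)) with hs
  have h0 : 0 < h := Real.sin_pos_of_pos_of_lt_pi (by linarith) (by linarith)
  have hsh : h ≤ s := Real.sin_le_sin_of_le_of_le_pi_div_two (by linarith) (min_le_right _ _)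
    (le_min (by linarith) (by linarith))
  -- `a` is the left end of the admissible range of `α`, whose right end is `θ / 2`
  obtain ⟨a, ha0, haα, haπ, hend⟩ : ∃ a, 0 ≤ a ∧ a ≤ α ∧ a ≤ θ ∧
      h * s ≤ h * Real.sin (θ - a) + Real.sin a * (s - h) := by
    rcases le_total θ (Real.pi / 2) with hc | hc
    · refine ⟨0, le_rfl, hα0, hθ.le, ?_⟩
      simp [hs, min_eq_left hc]
    · refine ⟨θ - Real.pi / 2, by linarith, hα1, by linarith, ?_⟩
      have h1 : 0 ≤ Real.sin (θ - Real.pi / 2) :=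
        Real.sin_nonneg_of_nonneg_of_le_pi (by linarith) (by linarith)
      have h2 : s ≤ 1 := Real.sin_le_one _
      rw [sub_sub_cancel, Real.sin_pi_div_two]
      nlinarith [mul_nonneg h1 (sub_nonneg.2 hsh), mul_nonneg h0.le (sub_nonneg.2 h2)]
  obtain ⟨x, y, hx, hy, hxy, rfl⟩ : α ∈ segment ℝ a (θ / 2) := by
    rw [segment_eq_Icc (haα.trans hα2)]
    exact ⟨haα, hα2⟩
  have c1 := strictConcaveOn_sin_Icc.concaveOn.2 (x := a) (y := θ / 2)
    ⟨ha0, by linarith⟩ ⟨by linarith, by linarith⟩ hx hy hxy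
  have c2 := strictConcaveOn_sin_Icc.concaveOn.2 (x := θ - a) (y := θ / 2)
    ⟨by linarith, by linarith⟩ ⟨by linarith, by linarith⟩ hx hy hxy
  simp only [smul_eq_mul] at c1 c2 ⊢
  have e2 : θ - (x * a + y * (θ / 2)) = x * (θ - a) + y * (θ / 2) := by
    linear_combination (-θ) * hxy
  rw [e2]
  calc h * s = x * (h * s) + y * (h * s) := by rw [← add_mul, hxy, one_mul]
    _ ≤ x * (h * Real.sin (θ - a) + Real.sin a * (s - h)) + y * (h * s) := by gcongr
    _ = h * (x * Real.sin (θ - a) + y * h) + (x * Real.sin a + y * h) * (s - h) := by ring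
    _ ≤ _ := by
      have := sub_nonneg.2 hsh
      gcongr

/-- A point at distance `r` from the apex of a wedge is seen at angles `α`, `β` from its sides,
where `θ ≤ α + β`, and is `ε`-close to one side and `(ε + l)`-close to the other. In the plane with
`θ = α + β ≤ π / 2` the extremal point is `(ε * cot (θ / 2) + l / sin θ, ε)`, the sum of a vector of
length `ε / sin (θ / 2)` and one of length `l / sin θ`; hence the shape of the bound. -/
theorem le_div_sin_add_div_sin {θ α β r ε l : ℝ} (hθ : 0 < θ) (hθπ : θ ≤ Real.pi)
    (hα0 : 0 ≤ α) (hαβ : θ ≤ α + β) (hr : 0 ≤ r) (hε : 0 ≤ ε) (hl : 0 ≤ l)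
    (h1 : r * Real.sin (min α (Real.pi / 2)) ≤ ε)
    (h2 : r * Real.sin (min β (Real.pi / 2)) ≤ ε + l) :
    r ≤ ε / Real.sin (θ / 2) + l / Real.sin (min θ (Real.pi / 2)) := by
  have hπ := Real.pi_pos
  have hkey := sin_half_mul_sin_min_le (α := α) hθ hθπ hα0
  set h := Real.sin (θ / 2) with hh
  set s := Real.sin (min θ (Real.pi / 2)) with hs
  have h0 : 0 < h := Real.sin_pos_of_pos_of_lt_pi (by linarith) (by linarith)
  have hsh : h ≤ s := Real.sin_le_sin_of_le_of_le_pi_div_two (by linarith) (min_le_right _ _)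
    (le_min (by linarith) (by linarith))
  have s0 : 0 < s := h0.trans_le hsh
  have hh1 : h ≤ 1 := Real.sin_le_one _
  have hs1 : s ≤ 1 := Real.sin_le_one _
  rcases le_or_gt (θ / 2) α with hc | hc
  · have h3 : h ≤ Real.sin (min α (Real.pi / 2)) :=
      Real.sin_le_sin_of_le_of_le_pi_div_two (by linarith) (min_le_right _ _)
        (le_min hc (by linarith))
    have h4 : r ≤ ε / h := by
      rw [le_div_iff₀ h0]
      exact (mul_le_mul_of_nonneg_left h3 hr).trans h1
    have : 0 ≤ l / s := by positivity
    linarith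
  · rw [min_eq_left (by linarith)] at h1
    rcases le_or_gt (Real.pi / 2) (θ - α) with hb | hb
    · rw [min_eq_right (by linarith), Real.sin_pi_div_two, mul_one] at h2
      have := le_div_self hε h0 hh1
      have := le_div_self hl s0 hs1
      linarith
    · have h3 : Real.sin (θ - α) ≤ Real.sin (min β (Real.pi / 2)) :=
        Real.sin_le_sin_of_le_of_le_pi_div_two (by linarith) (min_le_right _ _)
          (le_min (by linarith) (by linarith))
      have h4 := hkey (by linarith) hc.le
      rw [div_add_div _ _ h0.ne' s0.ne', le_div_iff₀ (by positivity)]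
      calc r * (h * s) ≤ r * (h * Real.sin (θ - α) + Real.sin α * (s - h)) := by gcongr
        _ = h * (r * Real.sin (θ - α)) + (r * Real.sin α) * (s - h) := by ring
        _ ≤ h * (ε + l) + ε * (s - h) := by
          have := sub_nonneg.2 hsh
          have := (mul_le_mul_of_nonneg_left h3 hr).trans h2
          gcongr
        _ = ε * s + h * l := by ring

/-- A point that is `ε`-close to one side of a wedge of angle at least `θ` and `(ε + l)`-close to
the other side is not far from the apex `v`. -/
theorem dist_apex_le {m : ℕ} {v a b c x y : EuclideanSpace ℝ (Fin m)} {θ ε l : ℝ}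
    (hθ : 0 < θ) (hθang : θ ≤ EuclideanGeometry.angle a v b) (hε : 0 ≤ ε) (hl : 0 ≤ l)
    (hx : x ∈ segment ℝ v a) (hy : y ∈ segment ℝ v b)
    (hcx : dist c x ≤ ε) (hcy : dist c y ≤ ε + l) :
    dist c v ≤ ε / Real.sin (θ / 2) + l / Real.sin (min θ (Real.pi / 2)) := by
  have side : ∀ z w : EuclideanSpace ℝ (Fin m), z ∈ segment ℝ v w →
      dist c v * Real.sin (min (InnerProductGeometry.angle (c - v) (w - v)) (Real.pi / 2)) ≤
        dist c z := by
    intro z w hz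
    rw [segment_eq_image'] at hz
    obtain ⟨t, ht, rfl⟩ := hz
    have := norm_mul_sin_min_angle_le (c - v) (w - v) ht.1
    rwa [← dist_eq_norm, sub_sub, ← dist_eq_norm] at this
  have htri := InnerProductGeometry.angle_le_angle_add_angle (a - v) (c - v) (b - v)
  rw [InnerProductGeometry.angle_comm (a - v) (c - v)] at htri
  rw [EuclideanGeometry.angle, vsub_eq_sub, vsub_eq_sub] at hθang
  exact le_div_sin_add_div_sin hθ (hθang.trans (InnerProductGeometry.angle_le_pi _ _))
    (InnerProductGeometry.angle_nonneg _ _) (hθang.trans htri) dist_nonneg hε hl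
    ((side x a hx).trans hcx) ((side y b hy).trans hcy)

/-! ### Spanning trees -/

/-- Deleting an edge `pq` from a connected graph leaves at most two components. -/
theorem SimpleGraph.Connected.reachable_deleteEdges_or {V : Type*} {W : SimpleGraph V}
    (hW : W.Connected) (p q x : V) :
    (W.deleteEdges {s(p, q)}).Reachable p x ∨ (W.deleteEdges {s(p, q)}).Reachable q x := by
  obtain ⟨w⟩ := hW.preconnected x p
  induction w with
  | nil => exact Or.inl (SimpleGraph.Reachable.refl _)
  | @cons x y z h w ih =>
    by_cases hxy : s(x, y) = s(z, q)
    · rcases Sym2.eq_iff.1 hxy with ⟨rfl, rfl⟩ | ⟨rfl, rfl⟩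
      · exact Or.inl (SimpleGraph.Reachable.refl _)
      · exact Or.inr (SimpleGraph.Reachable.refl _)
    · have hadj : (W.deleteEdges {s(z, q)}).Adj y x := by
        rw [SimpleGraph.deleteEdges_adj]
        exact ⟨h.symm, fun h' => hxy (Sym2.eq_swap.trans h')⟩
      exact ih.imp (fun h' => h'.trans hadj.reachable) fun h' => h'.trans hadj.reachable

/-- Exchanging an edge `pq` of a connected graph for an edge `rq`, where `r` stays connected to
`p`, keeps the graph connected. -/
theorem SimpleGraph.Connected.deleteEdges_sup_edge {V : Type*} {W : SimpleGraph V}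
    (hW : W.Connected) {p q r : V} (hr : (W.deleteEdges {s(p, q)}).Reachable p r) :
    (W.deleteEdges {s(p, q)} ⊔ SimpleGraph.edge r q).Connected := by
  set U := W.deleteEdges {s(p, q)} with hU
  have hpq : (U ⊔ SimpleGraph.edge r q).Reachable p q := by
    refine (hr.mono le_sup_left).trans ?_
    by_cases hrq : r = q
    · rw [hrq]
    · exact SimpleGraph.Adj.reachable
        (Or.inr ((SimpleGraph.edge_adj ..).2 ⟨Or.inl ⟨rfl, rfl⟩, hrq⟩))
  have hall : ∀ x, (U ⊔ SimpleGraph.edge r q).Reachable p x := fun x =>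
    (hW.reachable_deleteEdges_or p q x).elim (fun h => h.mono le_sup_left)
      fun h => hpq.trans (h.mono le_sup_left)
  have := hW.nonempty
  exact ⟨fun x y => (hall x).symm.trans (hall y)⟩

/-- The cycle property: an edge `pq` of a minimum spanning tree cannot be bypassed through a
vertex `r` by two lighter edges. -/
theorem IsMinSpanningTree.le_max {V : Type*} [Fintype V] {w : Sym2 V → ℝ} {W : SimpleGraph V}
    (hW : IsMinSpanningTree w W) (hw : ∀ e, 0 ≤ w e) {p q : V} (hpq : W.Adj p q) (r : V) :
    w s(p, q) ≤ max (w s(p, r)) (w s(r, q)) := by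
  classical
  -- it suffices to treat the case in which `r` stays connected to the first endpoint
  have key : ∀ p q : V, W.Adj p q → (W.deleteEdges {s(p, q)}).Reachable p r →
      w s(p, q) ≤ w s(r, q) := by
    intro p q hpq hr
    obtain ⟨F, hF, hFT⟩ := (hW.1.connected.deleteEdges_sup_edge hr).exists_isTree_le
    have hsub : F.edgeFinset ⊆ insert s(r, q) (W.edgeFinset.erase s(p, q)) := by
      intro e he
      induction e with | _ x y
      rw [SimpleGraph.mem_edgeFinset, SimpleGraph.mem_edgeSet] at he
      rcases hF he with h | h
      · rw [SimpleGraph.deleteEdges_adj] at h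
        simp only [Finset.mem_insert, Finset.mem_erase, SimpleGraph.mem_edgeFinset,
          SimpleGraph.mem_edgeSet]
        exact Or.inr ⟨h.2, h.1⟩
      · rw [SimpleGraph.edge_adj] at h
        rw [Finset.mem_insert, eq_comm, Sym2.eq_iff]
        left
        rcases h.1 with h | h
        · exact Or.inl ⟨h.1.symm, h.2.symm⟩
        · exact Or.inr ⟨h.2.symm, h.1.symm⟩
    have h1 := hW.2 F hFT
    have h2 : ∑ e ∈ F.edgeFinset, w e ≤ w s(r, q) + ∑ e ∈ W.edgeFinset.erase s(p, q), w e :=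
      (Finset.sum_le_sum_of_subset_of_nonneg hsub fun e _ _ => hw e).trans (by
        by_cases hmem : s(r, q) ∈ W.edgeFinset.erase s(p, q)
        · rw [Finset.insert_eq_of_mem hmem]
          linarith [hw s(r, q)]
        · rw [Finset.sum_insert hmem])
    have h3 := Finset.add_sum_erase W.edgeFinset w (a := s(p, q))
      (SimpleGraph.mem_edgeFinset.2 hpq)
    have h1' : ∑ e ∈ W.edgeFinset, w e ≤ ∑ e ∈ F.edgeFinset, w e := by convert h1
    linarith
  rcases hW.1.connected.reachable_deleteEdges_or p q r with h | h
  · exact (key p q hpq h).trans (le_max_right _ _)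
  · have := key q p hpq.symm (by rwa [Sym2.eq_swap])
    rw [Sym2.eq_swap, Sym2.eq_swap (a := r)] at this
    exact this.trans (le_max_left _ _)

/-! ### Edge lengths, angles and path lengths -/

section SpatialGraphs

variable {m : ℕ} {V : Finset (EuclideanSpace ℝ (Fin m))}

theorem dist_le_maxEdgeLength {G : SimpleGraph V} {a b : V} (h : G.Adj a b) :
    dist (a : EuclideanSpace ℝ (Fin m)) b ≤ maxEdgeLength G := by
  refine le_csSup ?_ ⟨a, b, h, rfl⟩
  refine ((Set.finite_range fun x : V × V =>
    dist (x.1 : EuclideanSpace ℝ (Fin m)) x.2).subset ?_).bddAbove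
  rintro r ⟨a, b, -, rfl⟩
  exact ⟨(a, b), rfl⟩

theorem maxEdgeLength_nonneg (G : SimpleGraph V) : 0 ≤ maxEdgeLength G := by
  apply Real.sSup_nonneg
  rintro r ⟨a, b, -, rfl⟩
  exact dist_nonneg

theorem minAngle_le (T : SimpleGraph V) {a b c : V} (hb : T.Adj a b) (hc : T.Adj a c)
    (hbc : b ≠ c) :
    minAngle T ≤ EuclideanGeometry.angle (b : EuclideanSpace ℝ (Fin m)) a c := by
  refine csInf_le ⟨0, ?_⟩ (Set.mem_insert_of_mem _ ⟨a, b, c, hb, hc, hbc, rfl⟩)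
  rintro r (rfl | ⟨a, b, c, -, -, -, rfl⟩)
  · exact Real.pi_pos.le
  · exact EuclideanGeometry.angle_nonneg _ _ _

/-- Two edges at angle zero would overlap, which a straight-line tree forbids. -/
theorem IsStraightLineTree.minAngle_pos {T : SimpleGraph V} (hT : IsStraightLineTree T) :
    0 < minAngle T := by
  have hfin : (insert Real.pi {r | ∃ a b c : V, T.Adj a b ∧ T.Adj a c ∧ b ≠ c ∧
      r = EuclideanGeometry.angle (b : EuclideanSpace ℝ (Fin m)) a c}).Finite := by
    refine Set.Finite.insert _ ((Set.finite_range fun x : V × V × V =>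
      EuclideanGeometry.angle (x.2.1 : EuclideanSpace ℝ (Fin m)) x.1 x.2.2).subset ?_)
    rintro r ⟨a, b, c, -, -, -, rfl⟩
    exact ⟨(a, b, c), rfl⟩
  have hmem := (Set.insert_nonempty _ _).csInf_mem hfin
  change minAngle T ∈ _ at hmem
  rcases hmem with h | ⟨a, b, c, hb, hc, hbc, h⟩
  · rw [h]
    exact Real.pi_pos
  · rw [h]
    refine lt_of_le_of_ne (EuclideanGeometry.angle_nonneg _ _ _) fun h0 => ?_
    obtain ⟨-, r, hr, hrc⟩ := InnerProductGeometry.angle_eq_zero_iff.1 h0.symm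
    simp only [vsub_eq_sub] at hrc
    -- the longer of the two edges contains the far endpoint of the shorter one
    rcases le_total r 1 with h1 | h1
    · have : (c : EuclideanSpace ℝ (Fin m)) ∈ segment ℝ (a : EuclideanSpace ℝ (Fin m)) b := by
        rw [segment_eq_image']
        exact ⟨r, ⟨hr.le, h1⟩, by simp only [← hrc]; abel⟩
      rcases hT.vertex_on_edge a b c hb this with rfl | rfl
      · exact hc.ne rfl
      · exact hbc rfl
    · have : (b : EuclideanSpace ℝ (Fin m)) ∈ segment ℝ (a : EuclideanSpace ℝ (Fin m)) c := by
        rw [segment_eq_image']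
        refine ⟨r⁻¹, ⟨(inv_pos.2 hr).le, inv_le_one_of_one_le₀ h1⟩, ?_⟩
        simp only [hrc, smul_smul, inv_mul_cancel₀ hr.ne', one_smul]
        abel
      rcases hT.vertex_on_edge a c b hc this with rfl | rfl
      · exact hb.ne rfl
      · exact hbc rfl

theorem walkLength_nonneg {G : SimpleGraph V} {a b : V} (p : G.Walk a b) : 0 ≤ walkLength p := by
  refine List.sum_nonneg fun x hx => ?_
  obtain ⟨d, -, rfl⟩ := List.mem_map.1 hx
  exact dist_nonneg

theorem walkLength_append {G : SimpleGraph V} {a b c : V} (p : G.Walk a b) (q : G.Walk b c) :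
    walkLength (p.append q) = walkLength p + walkLength q := by
  simp [walkLength]

theorem walkLength_cons {G : SimpleGraph V} {a b c : V} (h : G.Adj a b) (q : G.Walk b c) :
    walkLength (SimpleGraph.Walk.cons h q) =
      dist (a : EuclideanSpace ℝ (Fin m)) b + walkLength q := by
  simp [walkLength]

theorem pathDist_le_walkLength {G : SimpleGraph V} {a b : V} (p : G.Walk a b) :
    pathDist G a b ≤ walkLength p :=
  ciInf_le ⟨0, by rintro r ⟨p, rfl⟩; exact walkLength_nonneg p⟩ p

theorem pathDist_nonneg (G : SimpleGraph V) (a b : V) : 0 ≤ pathDist G a b :=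
  Real.iInf_nonneg walkLength_nonneg

theorem SimpleGraph.Connected.exists_walkLength_lt {G : SimpleGraph V} (hG : G.Connected)
    (a b : V) {η : ℝ} (hη : 0 < η) : ∃ p : G.Walk a b, walkLength p < pathDist G a b + η := by
  have : Nonempty (G.Walk a b) := hG.preconnected a b
  exact exists_lt_of_ciInf_lt (lt_add_of_pos_right _ hη)

theorem SimpleGraph.Connected.pathDist_le_walkLength_add {G : SimpleGraph V} (hG : G.Connected)
    {a b : V} (c : V) (p : G.Walk a b) : pathDist G a c ≤ walkLength p + pathDist G b c := by
  refine le_of_forall_pos_lt_add fun η hη => ?_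
  obtain ⟨q, hq⟩ := hG.exists_walkLength_lt b c hη
  have := pathDist_le_walkLength (p.append q)
  rw [walkLength_append] at this
  linarith

/-- A walk that leaves a set splits, lengthwise, at a step that leaves the set. -/
theorem exists_walkLength_split {G : SimpleGraph V} {a b : V} (p : G.Walk a b) (S : Set V)
    (ha : a ∈ S) (hb : b ∉ S) :
    ∃ (c d : V) (p₁ : G.Walk a c) (p₂ : G.Walk d b), G.Adj c d ∧ c ∈ S ∧ d ∉ S ∧
      walkLength p = walkLength p₁ + dist (c : EuclideanSpace ℝ (Fin m)) d + walkLength p₂ := by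
  induction p with
  | nil => exact absurd ha hb
  | @cons x y z h p ih =>
    by_cases hy : y ∈ S
    · obtain ⟨c, d, p₁, p₂, h', hc, hd, hlen⟩ := ih hy hb
      refine ⟨c, d, SimpleGraph.Walk.cons h p₁, p₂, h', hc, hd, ?_⟩
      rw [walkLength_cons, walkLength_cons, hlen]
      ring
    · refine ⟨x, y, SimpleGraph.Walk.nil, p, h, ha, hy, ?_⟩
      rw [walkLength_cons]
      simp [walkLength]

/-! ### Offsets of edges of the tree -/

/-- The closed `ε`-offset of the straight segment spanned by an unordered pair of points. -/
def edgeOffset (ε : ℝ) : Sym2 V → Set (EuclideanSpace ℝ (Fin m)) :=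
  Sym2.lift ⟨fun u v => offset (segment ℝ (u : EuclideanSpace ℝ (Fin m)) v) ε,
    fun u v => by simp only [segment_symm]⟩

theorem mem_edgeOffset_of_dist_le {ε : ℝ} {e : Sym2 V} {z : V} (hz : z ∈ e)
    {p : EuclideanSpace ℝ (Fin m)} (hp : dist p z ≤ ε) : p ∈ edgeOffset ε e := by
  obtain ⟨w, rfl⟩ := Sym2.mem_iff_exists.1 hz
  exact ⟨z, left_mem_segment ℝ _ _, hp⟩

open scoped Pointwise in
theorem convex_edgeOffset (ε : ℝ) (e : Sym2 V) : Convex ℝ (edgeOffset ε e) := by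
  induction e with | _ u v
  have : edgeOffset ε s(u, v) =
      segment ℝ (u : EuclideanSpace ℝ (Fin m)) v + Metric.closedBall 0 ε := by
    ext p
    rw [Set.mem_add]
    constructor
    · rintro ⟨q, hq, hpq⟩
      exact ⟨q, hq, p - q, by rwa [mem_closedBall_zero_iff, ← dist_eq_norm], by abel⟩
    · rintro ⟨q, hq, b, hb, rfl⟩
      exact ⟨q, hq, by rwa [dist_eq_norm, add_sub_cancel_left, ← mem_closedBall_zero_iff]⟩
  rw [this]
  exact (convex_segment _ _).add (convex_closedBall _ _)

variable {C D : Finset (EuclideanSpace ℝ (Fin m))} {T : SimpleGraph V} {G : SimpleGraph C}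
  {ε δ γ : ℝ}

theorem IsGammaApprox.pathDist_le_of_mem_edgeOffset (hG : IsGammaApprox T G ε γ) {e : Sym2 V}
    (he : e ∈ T.edgeSet) {a b : C} (ha : (a : EuclideanSpace ℝ (Fin m)) ∈ edgeOffset ε e)
    (hb : (b : EuclideanSpace ℝ (Fin m)) ∈ edgeOffset ε e) :
    pathDist G a b ≤ γ * dist (a : EuclideanSpace ℝ (Fin m)) b := by
  induction e with | _ u v
  exact hG.pathDist_le u v he a b ha hb

/-- Distinct edges of the tree whose offsets come within the length of one edge of `G` of each
other have a common vertex. -/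
theorem IsGammaApprox.exists_common_vertex (hG : IsGammaApprox T G ε γ) {e f : Sym2 V}
    (he : e ∈ T.edgeSet) (hf : f ∈ T.edgeSet) (hef : e ≠ f) {c d : EuclideanSpace ℝ (Fin m)}
    (hc : c ∈ edgeOffset ε e) (hd : d ∈ edgeOffset ε f) (hcd : dist c d ≤ maxEdgeLength G) :
    ∃ z a b : V, T.Adj z a ∧ T.Adj z b ∧ a ≠ b ∧ e = s(z, a) ∧ f = s(z, b) := by
  induction e with | _ u v
  induction f with | _ x y
  obtain ⟨c', hc', hcc'⟩ := hc
  obtain ⟨d', hd', hdd'⟩ := hd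
  have he' : T.Adj u v := he
  have hf' : T.Adj x y := hf
  have hshare : u = x ∨ u = y ∨ v = x ∨ v = y := by
    by_contra! hne
    have h1 := hG.lt_minDist u v x y he hf hne.1 hne.2.1 hne.2.2.1 hne.2.2.2
    have h2 : minDist (segment ℝ (u : EuclideanSpace ℝ (Fin m)) v)
        (segment ℝ (x : EuclideanSpace ℝ (Fin m)) y) ≤ dist c' d' :=
      csInf_le ⟨0, by rintro r ⟨a, -, b, -, rfl⟩; exact dist_nonneg⟩ ⟨c', hc', d', hd', rfl⟩
    have h3 := dist_triangle4 c' c d d'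
    rw [dist_comm c' c] at h3
    linarith
  rcases hshare with rfl | rfl | rfl | rfl
  · exact ⟨u, v, y, he', hf', fun h => hef (by rw [h]), rfl, rfl⟩
  · exact ⟨u, v, x, he', hf'.symm, fun h => hef (by rw [h, Sym2.eq_swap]), rfl, Sym2.eq_swap⟩
  · exact ⟨v, u, y, he'.symm, hf', fun h => hef (by rw [h, Sym2.eq_swap]), Sym2.eq_swap, rfl⟩
  · exact ⟨v, u, x, he'.symm, hf'.symm, fun h => hef (by rw [h]), Sym2.eq_swap, Sym2.eq_swap⟩

/-- The radius of the ball around a vertex `z` of the tree within which the offsets of two edges at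
`z` can come within distance `l` of each other. -/
noncomputable def wedgeRadius (T : SimpleGraph V) (ε l : ℝ) : ℝ :=
  ε / Real.sin (minAngle T / 2) + l / Real.sin (min (minAngle T) (Real.pi / 2))

theorem IsStraightLineTree.dist_le_wedgeRadius (hT : IsStraightLineTree T) (hε : 0 ≤ ε) {l : ℝ}
    {z a b : V} (ha : T.Adj z a) (hb : T.Adj z b) (hab : a ≠ b)
    {c d : EuclideanSpace ℝ (Fin m)} (hc : c ∈ edgeOffset ε s(z, a))
    (hd : d ∈ edgeOffset ε s(z, b)) (hcd : dist c d ≤ l) : dist c z ≤ wedgeRadius T ε l := by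
  obtain ⟨x, hx, hcx⟩ := hc
  obtain ⟨y, hy, hdy⟩ := hd
  refine dist_apex_le hT.minAngle_pos (minAngle_le T ha hb hab) hε (dist_nonneg.trans hcd) hx hy
    hcx ?_
  linarith [dist_triangle c d y]

/-- A point of the sparse set `D` that is close to two edges is the unique point of `D` close to
their common vertex. -/
theorem IsSparse.exists_eq_of_mem_edgeOffset_inter (hT : IsStraightLineTree T) (hε : 0 ≤ ε)
    (hγ : 1 ≤ γ) (hG : IsGammaApprox T G ε γ) {hDC : D ⊆ C} (hD : IsSparse G hDC δ)
    (hδ : 2 * γ * (ε + wedgeRadius T ε (maxEdgeLength G)) ≤ δ) {e f : Sym2 V}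
    (he : e ∈ T.edgeSet) (hf : f ∈ T.edgeSet) (hef : e ≠ f) (p : D)
    (hpe : (p : EuclideanSpace ℝ (Fin m)) ∈ edgeOffset ε e)
    (hpf : (p : EuclideanSpace ℝ (Fin m)) ∈ edgeOffset ε f) :
    ∃ z : V, z ∈ e ∧ z ∈ f ∧ ∀ a : D, dist (a : EuclideanSpace ℝ (Fin m)) z ≤ ε → a = p := by
  have hl : dist (p : EuclideanSpace ℝ (Fin m)) p ≤ maxEdgeLength G := by
    rw [dist_self]
    exact maxEdgeLength_nonneg G
  obtain ⟨z, x, y, hx, hy, hxy, rfl, rfl⟩ := hG.exists_common_vertex he hf hef hpe hpf hl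
  refine ⟨z, Sym2.mem_mk_left _ _, Sym2.mem_mk_left _ _, fun a ha => ?_⟩
  by_contra hap
  have hpz := hT.dist_le_wedgeRadius hε hx hy hxy hpe hpf hl
  have h1 := hD a p hap
  have h2 := hG.pathDist_le_of_mem_edgeOffset he (a := ⟨a, hDC a.2⟩) (b := ⟨p, hDC p.2⟩)
    (mem_edgeOffset_of_dist_le (Sym2.mem_mk_left _ _) ha) hpe
  have h3 := dist_triangle_right (a : EuclideanSpace ℝ (Fin m)) p z
  have h4 : 0 < dist (a : EuclideanSpace ℝ (Fin m)) p :=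
    dist_pos.2 fun h => hap (Subtype.ext h)
  simp only at h2
  have h5 : γ * dist (a : EuclideanSpace ℝ (Fin m)) p ≤
      γ * (ε + wedgeRadius T ε (maxEdgeLength G)) := by gcongr; linarith
  have h6 : 0 < γ * dist (a : EuclideanSpace ℝ (Fin m)) p := by positivity
  linarith

/-! ### Edges of the minimum spanning tree -/

theorem pathWeight_nonneg (G : SimpleGraph C) (hDC : D ⊆ C) (e : Sym2 D) :
    0 ≤ pathWeight G hDC e := by
  induction e with | _ a b
  exact pathDist_nonneg _ _ _

/-- The endpoints of an edge `pq` of a minimum spanning tree lie in the offset of one edge of `T`.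
Otherwise a nearly shortest walk in `G` from `p` to `q` leaves the offsets containing `p` close to a
vertex of `T`, and the point of `D` near that vertex bypasses `pq` by two shorter edges. -/
theorem exists_mem_edgeOffset_of_adj (hT : IsStraightLineTree T) (hε : 0 ≤ ε)
    (hγ : 1 ≤ γ) (hG : IsGammaApprox T G ε γ) {hDC : D ⊆ C} (hD : IsSparse G hDC δ)
    (hVD : (V : Set (EuclideanSpace ℝ (Fin m))) ⊆
      offset (D : Set (EuclideanSpace ℝ (Fin m))) ε)
    (hδ : 2 * γ * (ε + wedgeRadius T ε (maxEdgeLength G)) ≤ δ)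
    (hcov : ∀ c ∈ C, ∃ e ∈ T.edgeSet, c ∈ edgeOffset ε e)
    {W : SimpleGraph D} (hW : IsMinSpanningTree (pathWeight G hDC) W) {p q : D}
    (hpq : W.Adj p q) :
    ∃ e ∈ T.edgeSet, (p : EuclideanSpace ℝ (Fin m)) ∈ edgeOffset ε e ∧
      (q : EuclideanSpace ℝ (Fin m)) ∈ edgeOffset ε e := by
  by_contra hcon
  set P : C := ⟨p, hDC p.2⟩ with hP
  set Q : C := ⟨q, hDC q.2⟩ with hQ
  set ρ := wedgeRadius T ε (maxEdgeLength G) with hρ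
  let S : Set C := {x | ∃ e ∈ T.edgeSet, (p : EuclideanSpace ℝ (Fin m)) ∈ edgeOffset ε e ∧
    (x : EuclideanSpace ℝ (Fin m)) ∈ edgeOffset ε e}
  have hPS : P ∈ S := by
    obtain ⟨e, he, hpe⟩ := hcov p (hDC p.2)
    exact ⟨e, he, hpe, hpe⟩
  have hQS : Q ∉ S := hcon
  -- slack that is outweighed by every edge of `G`
  have hη : 0 < (C : Set (EuclideanSpace ℝ (Fin m))).infsep :=
    (C.finite_toSet.infsep_pos_iff_nontrivial).2
      ⟨p, hDC p.2, q, hDC q.2, fun h => hpq.ne (Subtype.ext h)⟩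
  obtain ⟨w, hw⟩ := hG.connected.exists_walkLength_lt P Q hη
  obtain ⟨c, d, w₁, w₂, hcd, ⟨e, he, hpe, hce⟩, hdS, hlen⟩ := exists_walkLength_split w S hPS hQS
  have hηcd := Set.infsep_le_dist_of_mem (s := (C : Set (EuclideanSpace ℝ (Fin m)))) c.2 d.2
    fun h => hcd.ne (Subtype.ext h)
  obtain ⟨f, hf, hdf⟩ := hcov d d.2
  have hef : e ≠ f := by
    rintro rfl
    exact hdS ⟨e, he, hpe, hdf⟩
  obtain ⟨z, a, b, ha, hb, hab, rfl, rfl⟩ :=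
    hG.exists_common_vertex he hf hef hce hdf (dist_le_maxEdgeLength hcd)
  have hcz := hT.dist_le_wedgeRadius hε ha hb hab hce hdf (dist_le_maxEdgeLength hcd)
  have hdz := hT.dist_le_wedgeRadius hε hb ha hab.symm hdf hce (dist_le_maxEdgeLength hcd.symm)
  obtain ⟨r', hr', hzr⟩ := hVD z.2
  obtain ⟨r, rfl⟩ : ∃ r : D, (r : EuclideanSpace ℝ (Fin m)) = r' := ⟨⟨r', hr'⟩, rfl⟩
  rw [dist_comm] at hzr
  set R : C := ⟨r, hDC r.2⟩ with hR
  have hzR : dist (R : EuclideanSpace ℝ (Fin m)) z ≤ ε := hzr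
  have hre : (r : EuclideanSpace ℝ (Fin m)) ∈ edgeOffset ε s(z, a) :=
    mem_edgeOffset_of_dist_le (Sym2.mem_mk_left _ _) hzr
  have hrf : (r : EuclideanSpace ℝ (Fin m)) ∈ edgeOffset ε s(z, b) :=
    mem_edgeOffset_of_dist_le (Sym2.mem_mk_left _ _) hzr
  have hpr : p ≠ r := by
    rintro rfl
    exact hdS ⟨_, hf, hrf, hdf⟩
  have hrq : r ≠ q := by
    rintro rfl
    exact hQS ⟨_, he, hpe, hre⟩
  have hcr : pathDist G c R ≤ γ * (ε + ρ) := by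
    refine (hG.pathDist_le_of_mem_edgeOffset he (a := c) (b := R) hce hre).trans ?_
    have := dist_triangle_right (c : EuclideanSpace ℝ (Fin m)) R z
    gcongr
    linarith
  have hdr : pathDist G d R ≤ γ * (ε + ρ) := by
    refine (hG.pathDist_le_of_mem_edgeOffset hf (a := d) (b := R) hdf hrf).trans ?_
    have := dist_triangle_right (d : EuclideanSpace ℝ (Fin m)) R z
    gcongr
    linarith
  have hPR := hG.connected.pathDist_le_walkLength_add R w₁
  have hQR := hG.connected.pathDist_le_walkLength_add R w₂.reverse
  rw [walkLength_reverse, pathDist_comm] at hQR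
  have hsp : δ ≤ pathDist G P R := hD p r hpr
  have hsq : δ ≤ pathDist G R Q := hD r q hrq
  have hmax : pathDist G P Q ≤ max (pathDist G P R) (pathDist G R Q) :=
    hW.le_max (pathWeight_nonneg G hDC) hpq r
  rcases le_max_iff.1 hmax with h | h <;> linarith

/-! ### Covering the tree -/

/-- If `a` projects to the line `uv` at or beyond a point `x` of the segment, then `x` is at least as
close to `a` as the endpoint `u` is. -/
theorem dist_le_of_inner_le {u v x a : EuclideanSpace ℝ (Fin m)} (hx : x ∈ segment ℝ u v)
    (h : inner ℝ (x - u) (v - u) ≤ inner ℝ (a - u) (v - u)) : dist a x ≤ dist a u := by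
  rw [segment_eq_image'] at hx
  obtain ⟨t, ht, rfl⟩ := hx
  rw [add_sub_cancel_left, inner_smul_left, real_inner_self_eq_norm_sq] at h
  simp only [conj_trivial] at h
  rw [dist_eq_norm, dist_eq_norm, ← sub_sub]
  apply le_of_sq_le_sq _ (norm_nonneg _)
  rw [norm_sub_sq_real, inner_smul_right, norm_smul, mul_pow, Real.norm_of_nonneg ht.1]
  nlinarith [mul_le_mul_of_nonneg_left h ht.1, sq_nonneg (t * ‖v - u‖)]

/-- A segment joining two points of the offset of an edge `uv` whose projections to the line `uv`
lie on different sides of a point `x` of the edge passes within `ε` of `x`. -/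
theorem exists_mem_segment_dist_le {u v : V} {x p q : EuclideanSpace ℝ (Fin m)}
    (hx : x ∈ segment ℝ (u : EuclideanSpace ℝ (Fin m)) v)
    (hp : p ∈ edgeOffset ε s(u, v)) (hq : q ∈ edgeOffset ε s(u, v))
    (hpx : inner ℝ (p - u) ((v : EuclideanSpace ℝ (Fin m)) - u) ≤ inner ℝ (x - u) (v - u))
    (hxq : inner ℝ (x - u) ((v : EuclideanSpace ℝ (Fin m)) - u) ≤ inner ℝ (q - u) (v - u)) :
    ∃ y ∈ segment ℝ p q, dist x y ≤ ε := by
  set n : EuclideanSpace ℝ (Fin m) := v - u with hn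
  obtain ⟨y, hy, hyx⟩ : ∃ y ∈ segment ℝ p q, inner ℝ (y - u) n = inner ℝ (x - u) n := by
    have hcont : ContinuousOn (fun y : EuclideanSpace ℝ (Fin m) => inner ℝ (y - u) n)
        (segment ℝ p q) := by fun_prop
    exact (convex_segment p q).isPreconnected.intermediate_value (left_mem_segment ℝ p q)
      (right_mem_segment ℝ p q) hcont ⟨hpx, hxq⟩
  refine ⟨y, hy, ?_⟩
  obtain ⟨z, hz, hyz⟩ := (convex_edgeOffset ε s(u, v)).segment_subset hp hq hy
  refine le_trans ?_ hyz
  -- `y - x` is perpendicular to the edge, so `x` is the point of the edge closest to `y`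
  have hperp : inner ℝ (y - x) (z - x) = 0 := by
    rw [segment_eq_image'] at hx hz
    obtain ⟨t, -, ht⟩ := hx
    obtain ⟨s, -, hs⟩ := hz
    have h1 : z - x = (s - t) • n := by
      rw [← ht, ← hs, sub_smul]
      exact add_sub_add_left_eq_sub _ _ _
    have h2 : y - x = (y - u) - (x - u) := by abel
    rw [h1, inner_smul_right, h2, inner_sub_left, hyx, sub_self, mul_zero]
  rw [dist_comm, dist_eq_norm, dist_eq_norm]
  apply le_of_sq_le_sq _ (norm_nonneg _)
  have h3 : y - z = (y - x) - (z - x) := by abel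
  rw [h3, norm_sub_sq_real (y - x) (z - x), hperp]
  nlinarith [sq_nonneg ‖z - x‖]

/-- Every edge `uv` of the tree lies in the `ε`-offset of the minimum spanning tree. Given a point
`x` of the edge, the points of `D` before `x`, together with those near the part of the tree on
the side of `u`, form a cut; an edge of the spanning tree across the cut passes by `x`. -/
theorem exists_mem_spatialRealization_dist_le (hT : IsStraightLineTree T) (hε : 0 ≤ ε)
    (hγ : 1 ≤ γ) (hG : IsGammaApprox T G ε γ) {hDC : D ⊆ C} (hD : IsSparse G hDC δ)
    (hVD : (V : Set (EuclideanSpace ℝ (Fin m))) ⊆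
      offset (D : Set (EuclideanSpace ℝ (Fin m))) ε)
    (hδ : 2 * γ * (ε + wedgeRadius T ε (maxEdgeLength G)) ≤ δ)
    (hcov : ∀ c ∈ C, ∃ e ∈ T.edgeSet, c ∈ edgeOffset ε e)
    {W : SimpleGraph D} (hW : IsMinSpanningTree (pathWeight G hDC) W) {u v : V}
    (huv : T.Adj u v) {x : EuclideanSpace ℝ (Fin m)}
    (hx : x ∈ segment ℝ (u : EuclideanSpace ℝ (Fin m)) v) :
    ∃ y ∈ spatialRealization W, dist x y ≤ ε := by
  have hnear : ∀ z : V, ∃ a : D, dist (a : EuclideanSpace ℝ (Fin m)) z ≤ ε := fun z => by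
    obtain ⟨a, ha, hza⟩ := hVD z.2
    exact ⟨⟨a, ha⟩, by rwa [dist_comm]⟩
  obtain ⟨a, ha⟩ := hnear u
  obtain ⟨b, hb⟩ := hnear v
  set n : EuclideanSpace ℝ (Fin m) := v - u with hn
  rcases le_or_gt (inner ℝ (x - u) n) (inner ℝ ((a : EuclideanSpace ℝ (Fin m)) - u) n) with
    hxa | hax
  · exact ⟨a, Or.inl a.2, by rw [dist_comm]; exact (dist_le_of_inner_le hx hxa).trans ha⟩
  rcases le_or_gt (inner ℝ ((b : EuclideanSpace ℝ (Fin m)) - u) n) (inner ℝ (x - u) n) with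
    hbx | hxb
  · refine ⟨b, Or.inl b.2, ?_⟩
    rw [dist_comm]
    refine (dist_le_of_inner_le (u := (v : EuclideanSpace ℝ (Fin m))) (v := u)
      (by rwa [segment_symm]) ?_).trans hb
    have h1 : ∀ y : EuclideanSpace ℝ (Fin m), inner ℝ (y - v) ((u : EuclideanSpace ℝ (Fin m)) - v) =
        inner ℝ n n - inner ℝ (y - u) n := fun y => by
      have h2 : y - v = (y - u) - n := by rw [hn]; abel
      rw [h2, ← neg_sub (v : EuclideanSpace ℝ (Fin m)) u, ← hn, inner_neg_right, inner_sub_left]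
      ring
    rw [h1, h1]
    linarith
  have hub : u ∈ s(u, v) := Sym2.mem_mk_left _ _
  have hvb : v ∈ s(u, v) := Sym2.mem_mk_right _ _
  have hae := mem_edgeOffset_of_dist_le hub ha
  set T' := T.deleteEdges {s(u, v)} with hT'
  have hbridge : ¬ T'.Reachable u v :=
    SimpleGraph.isAcyclic_iff_forall_adj_isBridge.1 hT.isTree.isAcyclic huv
  -- the edges other than `uv` all of whose vertices lie on the side of `u`
  let L : Set (Sym2 V) := {f | f ∈ T.edgeSet ∧ f ≠ s(u, v) ∧ ∀ z ∈ f, T'.Reachable u z}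
  have hR : ∀ f ∈ T.edgeSet, f ≠ s(u, v) → f ∉ L → ∀ z ∈ f, T'.Reachable v z := by
    intro f hf hfe hfL z hz
    refine (hT.isTree.connected.reachable_deleteEdges_or u v z).resolve_left fun h => ?_
    refine hfL ⟨hf, hfe, fun z' hz' => ?_⟩
    obtain ⟨w, rfl⟩ := Sym2.mem_iff_exists.1 hz
    have hadj : T'.Adj z w := (SimpleGraph.deleteEdges_adj ..).2 ⟨hf, hfe⟩
    rcases Sym2.mem_iff.1 hz' with rfl | rfl
    · exact h
    · exact h.trans hadj.reachable
  let S : Set D := {d | ((d : EuclideanSpace ℝ (Fin m)) ∈ edgeOffset ε s(u, v) ∧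
      inner ℝ ((d : EuclideanSpace ℝ (Fin m)) - u) n ≤ inner ℝ (x - u) n) ∨
    ∃ f ∈ L, (d : EuclideanSpace ℝ (Fin m)) ∈ edgeOffset ε f}
  -- within the offset of `uv`, the cut separates the points by their projections
  have hS : ∀ d ∈ S, (d : EuclideanSpace ℝ (Fin m)) ∈ edgeOffset ε s(u, v) →
      inner ℝ ((d : EuclideanSpace ℝ (Fin m)) - u) n ≤ inner ℝ (x - u) n := by
    rintro d (h | ⟨f, ⟨hf, hfe, hfL⟩, hdf⟩) hde
    · exact h.2
    · obtain ⟨z, hze, hzf, hz⟩ :=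
        hD.exists_eq_of_mem_edgeOffset_inter hT hε hγ hG hδ huv hf hfe.symm d hde hdf
      rcases Sym2.mem_iff.1 hze with rfl | rfl
      · rw [← hz a ha]
        exact hax.le
      · exact absurd (hfL z hzf) hbridge
  have haS : a ∈ S := Or.inl ⟨hae, hax.le⟩
  have hbS : b ∉ S := fun h => (hS b h (mem_edgeOffset_of_dist_le hvb hb)).not_gt hxb
  obtain ⟨w⟩ := hW.1.connected.preconnected a b
  obtain ⟨d, -, hdS, hdS'⟩ := w.exists_boundary_dart S haS hbS
  obtain ⟨f, hf, hpf, hqf⟩ := exists_mem_edgeOffset_of_adj hT hε hγ hG hD hVD hδ hcov hW d.adj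
  have hfe : f = s(u, v) := by
    by_contra hfe
    by_cases hfL : f ∈ L
    · exact hdS' (Or.inr ⟨f, hfL, hqf⟩)
    have hfR := hR f hf hfe hfL
    rcases hdS with ⟨hpe, hpx⟩ | ⟨g, ⟨hg, -, hgL⟩, hpg⟩
    · obtain ⟨z, hze, hzf, hz⟩ :=
        hD.exists_eq_of_mem_edgeOffset_inter hT hε hγ hG hδ huv hf (Ne.symm hfe) _ hpe hpf
      rcases Sym2.mem_iff.1 hze with rfl | rfl
      · exact hbridge (hfR z hzf).symm
      · rw [← hz b hb] at hpx
        exact hpx.not_gt hxb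
    · have hgf : g ≠ f := by
        rintro rfl
        exact hfL ⟨hg, hfe, hgL⟩
      obtain ⟨z, hzg, hzf, -⟩ :=
        hD.exists_eq_of_mem_edgeOffset_inter hT hε hγ hG hδ hg hf hgf _ hpg hpf
      exact hbridge ((hgL z hzg).trans (hfR z hzf).symm)
  subst hfe
  have hqx : inner ℝ (x - u) n ≤ inner ℝ ((d.snd : EuclideanSpace ℝ (Fin m)) - u) n := by
    by_contra! h
    exact hdS' (Or.inl ⟨hqf, h.le⟩)
  obtain ⟨y, hy, hxy⟩ := exists_mem_segment_dist_le hx hpf hqf (hS _ hdS hpf) hqx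
  exact ⟨y, Or.inr ⟨d.fst, d.snd, d.adj, hy⟩, hxy⟩

end SpatialGraphs

theorem mainTheorem2 {m : ℕ} {V C D : Finset (EuclideanSpace ℝ (Fin m))}
    (T : SimpleGraph V) (hT : IsStraightLineTree T)
    (ε δ γ : ℝ) (hε : 0 ≤ ε) (hγ : 1 ≤ γ)
    (hC : IsSample C T ε)
    (G : SimpleGraph C) (hG : IsGammaApprox T G ε γ)
    (hDC : D ⊆ C) (hD : IsSparse G hDC δ)
    (hVD : (V : Set (EuclideanSpace ℝ (Fin m))) ⊆
      offset (D : Set (EuclideanSpace ℝ (Fin m))) ε)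
    (hδ : 2 * γ * (ε + ε / Real.sin (minAngle T / 2) +
      maxEdgeLength G / Real.sin (min (minAngle T) (Real.pi / 2))) ≤ δ)
    (W : SimpleGraph D) (hW : IsMinSpanningTree (pathWeight G hDC) W) :
    (∀ p ∈ C, ∃ q ∈ spatialRealization W, dist p q ≤ 2 * ε) ∧
      directedHausdorffDist (spatialRealization W) C ≤ 2 * ε := by
  have hδ' : 2 * γ * (ε + wedgeRadius T ε (maxEdgeLength G)) ≤ δ := by
    rwa [wedgeRadius, ← add_assoc]
  have hvertex : ∀ z ∈ V, ∃ y ∈ spatialRealization W, dist z y ≤ ε := fun z hz => by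
    obtain ⟨a, ha, hza⟩ := hVD hz
    exact ⟨a, Or.inl ha, hza⟩
  have hcover : ∀ x ∈ spatialRealization T, ∃ y ∈ spatialRealization W, dist x y ≤ ε := by
    rintro x (hx | ⟨u, v, huv, hx⟩)
    · exact hvertex x hx
    · -- since `T` is connected and has an edge, each of its vertices lies on an edge
      have hcov : ∀ c ∈ C, ∃ e ∈ T.edgeSet, c ∈ edgeOffset ε e := by
        intro c hc
        obtain ⟨y, hy | ⟨a, b, hab, hy⟩, hcy⟩ := hC c hc
        · have : Nontrivial V := ⟨u, v, huv.ne⟩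
          obtain ⟨w, hw⟩ := hT.isTree.connected.preconnected.exists_adj_of_nontrivial ⟨y, hy⟩
          exact ⟨s(⟨y, hy⟩, w), hw, mem_edgeOffset_of_dist_le (Sym2.mem_mk_left _ _) hcy⟩
        · exact ⟨s(a, b), hab, y, hy, hcy⟩
      exact exists_mem_spatialRealization_dist_le hT hε hγ hG hD hVD hδ' hcov hW huv hx
  have hmain : ∀ p ∈ C, ∃ q ∈ spatialRealization W, dist p q ≤ 2 * ε := by
    intro p hp
    obtain ⟨x, hx, hpx⟩ := hC p hp
    obtain ⟨y, hy, hxy⟩ := hcover x hx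
    exact ⟨y, hy, by linarith [dist_triangle p x y]⟩
  refine ⟨hmain, Real.iSup_le (fun p => ?_) (by positivity)⟩
  obtain ⟨q, hq, hpq⟩ := hmain p p.2
  exact (Metric.infDist_le_dist_of_mem hq).trans hpq
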